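/- All posets are finite. For a poset $P=(X,\le)$ and $x\in X$ let $D(x)=\{y: y<x\}$ and $U(x)=\{y:y>x\}$. $P$ is a *semiorder* if there are closed bounded real intervals $I(x)$ $(x\in X)$, all of the same length, with $x<y$ if and only if $I(x)$ lies completely to the left of $I(y)$; it is an *interval order* if the same holds without the condition on the lengths. If $D_0\subsetneq D_1\subsetneq\cdots\subsetneq D_{t-1}$ are the distinct down sets $D(x)$ of an interval order and $U_0\supsetneq U_1\supsetneq\cdots\supsetneq U_{t-1}$ its distinct up sets $U(x)$, its *minimal endpoint representation* assigns to $x$ the interval $[i,j]$ with $D(x)=D_i$ and $U(x)=U_j$. An *ascent sequence* is a sequence $(x_1,\dots,x_n)$, $n\ge 1$, of nonnegative integers with $x_1=0$ and $x_m\le 1+\#\{1\le j<m-1 : x_j<x_{j+1}\}$ for $2\le m\le n$. It determines an interval order $\Psi^{-1}(x_1,\dots,x_n)$ on $n$ points, given by a multiset of $n$ intervals, as follows. $(0)$ gives $\{[0,0]\}$. Suppose that $(x_1,\dots,x_{n-1})$ gives the multiset $R$; let $\ell$ be the largest right endpoint in $R$, let $\ell^*$ be the smallest left endpoint of an interval of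 $R$ with right endpoint $\ell$, and let $i=x_n$. If $i\le \ell^*$, add $[i,\ell]$. If $i=\ell+1$, add $[\ell+1,\ell+1]$. If $\ell^*<i\le \ell$, replace each $[\lambda,\rho]\in R$ by $[\lambda,\rho+1]$ if $\lambda<i\le\rho<\ell$, by $[\lambda+1,\rho+1]$ if $i\le\lambda$, and by $[\lambda,i]$ if $\lambda<i$ and $\rho=\ell$, leave the other intervals unchanged, and add $[i,\ell+1]$. (By Bousquet-Mélou, Claesson, Dukes and Kitaev, $\Psi^{-1}$ is a bijection from ascent sequences of length $n$ to unlabelled interval orders on $n$ points.) A semiorder $P$ on $n\geq 1$ points with $P\cong\Psi^{-1}(x_1,\dots,x_n)$ is *hereditary* if $\Psi^{-1}(x_1,\dots,x_i)$ is a semiorder for every $1\le i\le n$. *Blocks.* The trivial block is $T_0=\{[0,0]\}$. For an integer $b\ge 0$ the nontrivial blocks are $$T_1^b=\{[b,b],[b+1,b+1]\},\qquad W_k^b=\{[b,b],[b+k,b+k]\}\cup\bigcup_{i=0}^{k-1}\{[b+i,b+i+1]\}\quad(k\ge 1),$$ $$C_2^b=\{[b,b],[b,b+1],[b,b+2],[b+1,b+2],[b+2,b+2]\},$$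 $$U_k^b=\bigcup_{i=0}^{k-1}\{[b,b+i],[b+k-i,b+k]\}\quad(k\ge 3),\qquad C_k^b=\{[b,b+k]\}\cup U_k^b\quad(k\ge 3).$$ *Boundaries.* Two consecutive nontrivial blocks $A_{k}^{b}$, $B_{m}^{b+k}$ can be joined at $p=b+k$ in the following ways. * A *strong boundary*, always allowed: take the union of the intervals. * A *weak boundary*, allowed if neither block is a $T_1$ and not both are of the form $W$: take the union and remove $[p,p]$. * A *weak boundary with optional interval*, allowed if the first block is a $U_k$ $(k\ge3)$ or a $C_k$ $(k\ge 2)$ and the second is a $W_m$ or $C_2$: take the union, remove $[p,p]$ and add $[p-1,p+1]$. A *block description* is either $T_0$ alone, or a nonempty finite sequence of nontrivial blocks, the first with superscript $0$ and each later one with superscript equal to the sum of the superscript and the subscript of the block before it, together with an allowed boundary between any two consecutive blocks. It describes the set of intervals obtained by joining all its blocks across its boundaries. **Theorem.** If $P$ is a hereditary semiorder, then there is exactly one block description whose set of intervals is the set of intervals that occur in the minimal endpoint representation of $P$. -/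

import Mathlib

namespace HereditarySemiorder

/-! ### Interval orders, semiorders, minimal endpoint representations -/

/-- The closed bounded real intervals `[left x, right x]` represent the strict order `r`:
`x` is below `y` exactly when the interval of `x` lies completely to the left of that of `y`. -/
def IsIntervalRep {α : Type*} (r : α → α → Prop) (left right : α → ℝ) : Prop :=
  (∀ x, left x ≤ right x) ∧ ∀ x y, r x y ↔ right x < left y

/-- The strict order `r` is a semiorder: it has an interval representation in which all
intervals have the same length. -/
def IsSemiorder {α : Type*} (r : α → α → Prop) : Prop :=
  ∃ left right : α → ℝ, IsIntervalRep r left right ∧ ∃ c : ℝ, ∀ x, right x - left x = c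

/-- The interval of `x` in the minimal endpoint representation. If the distinct down sets are
`D₀ ⊊ D₁ ⊊ ⋯` and the distinct up sets are `U₀ ⊋ U₁ ⊋ ⋯`, this is the pair `(i, j)` with
`down x = Dᵢ` and `up x = Uⱼ`: the index `i` is the number of distinct down sets strictly
contained in `down x`, and `j` is the number of distinct up sets strictly containing `up x`. -/
noncomputable def minEndpointInterval {α : Type*} [PartialOrder α] (x : α) : ℕ × ℕ :=
  ({D : Set α | (∃ y, D = Set.Iio y) ∧ D ⊂ Set.Iio x}.ncard,
   {U : Set α | (∃ y, U = Set.Ioi y) ∧ Set.Ioi x ⊂ U}.ncard)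

/-- The set of intervals that occur in the minimal endpoint representation of `α`. -/
def minEndpointIntervals (α : Type*) [PartialOrder α] : Set (ℕ × ℕ) :=
  Set.range (minEndpointInterval (α := α))

/-! ### Ascent sequences and the corresponding interval orders -/

/-- The number of ascents of a sequence. -/
def asc (x : List ℕ) : ℕ :=
  (x.zip x.tail).countP (fun p => p.1 < p.2)

/-- Ascent sequences: the first term is `0`, and each later term is at most one more than the
number of ascents of the terms before it. -/
def IsAscentSeq (x : List ℕ) : Prop :=
  x.head? = some 0 ∧ ∀ (i : ℕ) (h : i + 1 < x.length), x[i + 1] ≤ 1 + asc (x.take (i + 1))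

/-- The largest right endpoint of a list of intervals. -/
def largestRight (R : List (ℕ × ℕ)) : ℕ :=
  (R.map Prod.snd).foldr max 0

/-- The smallest left endpoint of an interval whose right endpoint is the largest one
(the default value is only used for the empty list). -/
def smallestLeft (R : List (ℕ × ℕ)) : ℕ :=
  ((R.filter (fun I => I.2 = largestRight R)).map Prod.fst).min?.getD 0

/-- What the third move does to an interval that is already present; `l` is the largest right
endpoint and `i` the inserted endpoint. -/
def moveThree (l i : ℕ) (I : ℕ × ℕ) : ℕ × ℕ :=
  if i ≤ I.1 then (I.1 + 1, I.2 + 1)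
  else if I.2 = l then (I.1, i)
  else if i ≤ I.2 then (I.1, I.2 + 1)
  else I

/-- The step that appends the term `i` to an ascent sequence. An ascent sequence only uses
`i ≤ largestRight R + 1`, so that the last case is `i = largestRight R + 1`. -/
def step (R : List (ℕ × ℕ)) (i : ℕ) : List (ℕ × ℕ) :=
  if i ≤ smallestLeft R then (i, largestRight R) :: R
  else if i ≤ largestRight R then
    (i, largestRight R + 1) :: R.map (moveThree (largestRight R) i)
  else (largestRight R + 1, largestRight R + 1) :: R

/-- The intervals (one for each point, repetitions allowed) of the interval order that the
bijection between ascent sequences and unlabelled interval orders assigns to `x`. -/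
def intervalsOfSeq : List ℕ → List (ℕ × ℕ)
  | [] => []
  | _ :: xs => xs.foldl step [(0, 0)]

/-- The strict order on (the positions of) a list of intervals: completely to the left. -/
def precedes (R : List (ℕ × ℕ)) (a b : Fin R.length) : Prop :=
  (R.get a).2 < (R.get b).1

/-- `x` is the ascent sequence corresponding to the poset `α`: `α` is isomorphic to the interval
order constructed from `x`. -/
def Corresponds (α : Type*) [PartialOrder α] (x : List ℕ) : Prop :=
  IsAscentSeq x ∧
    Nonempty ((fun a b : α => a < b) ≃r precedes (intervalsOfSeq x))

/-- Hereditary semiorders: every nonempty initial segment of the corresponding ascent sequence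
corresponds to a semiorder. -/
def IsHereditarySemiorder (α : Type*) [PartialOrder α] : Prop :=
  IsSemiorder (fun a b : α => a < b) ∧
    ∃ x : List ℕ, Corresponds α x ∧
      ∀ i, 1 ≤ i → i ≤ x.length → IsSemiorder (precedes (intervalsOfSeq (x.take i)))

/-! ### Blocks and boundaries -/

/-- The nontrivial fundamental blocks, without their positions. -/
inductive Block : Type
  | T1 : Block
  | W (k : ℕ) (hk : 1 ≤ k) : Block
  | C2 : Block
  | U (k : ℕ) (hk : 3 ≤ k) : Block
  | C (k : ℕ) (hk : 3 ≤ k) : Block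

/-- The subscript of a block. -/
def Block.size : Block → ℕ
  | .T1 => 1
  | .W k _ => k
  | .C2 => 2
  | .U k _ => k
  | .C k _ => k

/-- The intervals of `U_k^b`. -/
def uIntervals (b k : ℕ) : Set (ℕ × ℕ) :=
  {I | ∃ i < k, I = (b, b + i) ∨ I = (b + k - i, b + k)}

/-- The intervals of a block placed at `b` (the superscript). -/
def Block.intervals (b : ℕ) : Block → Set (ℕ × ℕ)
  | .T1 => {(b, b), (b + 1, b + 1)}
  | .W k _ => {(b, b), (b + k, b + k)} ∪ {I | ∃ i < k, I = (b + i, b + i + 1)}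
  | .C2 => {(b, b), (b, b + 1), (b, b + 2), (b + 1, b + 2), (b + 2, b + 2)}
  | .U k _ => uIntervals b k
  | .C k _ => {(b, b + k)} ∪ uIntervals b k

def Block.IsT : Block → Prop
  | .T1 => True
  | _ => False

def Block.IsW : Block → Prop
  | .W _ _ => True
  | _ => False

def Block.IsC2 : Block → Prop
  | .C2 => True
  | _ => False

/-- The block is a `𝒞` (`C₂` included) or a `𝒰`. -/
def Block.IsCOrU : Block → Prop
  | .C2 => True
  | .U _ _ => True
  | .C _ _ => True
  | _ => False

/-- Strong boundary, weak boundary, weak boundary with optional interval. -/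
inductive Boundary : Type
  | strong : Boundary
  | weak : Boundary
  | weakOptional : Boundary

/-- `β.Permitted A B`: the block `A` may be followed by the block `B` across `β`. -/
def Boundary.Permitted : Boundary → Block → Block → Prop
  | .strong, _, _ => True
  | .weak, A, B => ¬ A.IsT ∧ ¬ B.IsT ∧ ¬ (A.IsW ∧ B.IsW)
  | .weakOptional, A, B => A.IsCOrU ∧ (B.IsW ∨ B.IsC2)

/-- Join two sets of intervals across a boundary located at `p`. -/
def Boundary.join (p : ℕ) : Boundary → Set (ℕ × ℕ) → Set (ℕ × ℕ) → Set (ℕ × ℕ)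
  | .strong, X, Y => X ∪ Y
  | .weak, X, Y => (X ∪ Y) \ {(p, p)}
  | .weakOptional, X, Y => ((X ∪ Y) \ {(p, p)}) ∪ {(p - 1, p + 1)}

/-- In the chain `A β₁ A₁ β₂ A₂ ⋯` every boundary is permitted between its two blocks. -/
def ChainPermitted : Block → List (Boundary × Block) → Prop
  | _, [] => True
  | A, (β, B) :: rest => β.Permitted A B ∧ ChainPermitted B rest

/-- The intervals of the chain `A β₁ A₁ β₂ A₂ ⋯` whose first block is placed at `b`; each block
is placed where the previous one ends. -/
def chainIntervals (b : ℕ) : Block → List (Boundary × Block) → Set (ℕ × ℕ)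
  | A, [] => A.intervals b
  | A, (β, B) :: rest =>
      β.join (b + A.size) (A.intervals b) (chainIntervals (b + A.size) B rest)

/-- A block description: the trivial block `T₀` on its own, or a nonempty chain of nontrivial
blocks with a boundary between any two consecutive ones. -/
inductive BlockStructure : Type
  | T0 : BlockStructure
  | chain (A : Block) (rest : List (Boundary × Block)) : BlockStructure

def BlockStructure.Permitted : BlockStructure → Prop
  | .T0 => True
  | .chain A rest => ChainPermitted A rest

/-- The intervals that a block description describes; the first block is placed at `0`. -/
def BlockStructure.intervals : BlockStructure → Set (ℕ × ℕ)
  | .T0 => {(0, 0)}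
  | .chain A rest => chainIntervals 0 A rest

end HereditarySemiorder

namespace HereditarySemiorder

/-! The intervals built from an ascent sequence use every number up to the largest right endpoint
both as a left and as a right endpoint (`IsFull`), and `step` preserves this. Such a representation
is automatically the minimal endpoint representation, and in it a semiorder cannot have an interval
strictly inside another (`IsFull.noNest`). For a hereditary semiorder, every prefix of the sequence
therefore gives an interval set satisfying `NoNest`, and this is all that existence uses.

Existence is an induction on the sequence. A step acts only near the right end, so it suffices to
know the last block and a little about the boundary before it. With `NoNest` after the step, only
these changes survive: every block may be followed strongly by `T1`; `T1` becomes `W 1`; `W k`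
becomes `W (k + 1)`; `W 2` becomes `C2`; for k ≥ 3, `W k` splits into `W (k - 2)` and `C2` at a weak
boundary; a weak boundary before `W 1` may acquire the optional interval; `C2` becomes `U 3`, `U k`
becomes `C k`, `C k` becomes `U (k + 1)`; and each of these three kinds may be followed weakly by `W
1`. All other moves leave the set unchanged or create a nesting (`Chain.step`).

Uniqueness is a reading procedure from left to right: the intervals near the left end determine the
first block, the intervals [p, p] and [p - 1, p + 1] determine the boundary at its end p, and the
intervals starting at or after p, with [p, p] restored, are those of the remaining chain
(`chainIntervals_injective`). -/

/-! ### Lists of intervals -/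

/-- `l` is the largest right endpoint of `S` and `m` the smallest left endpoint that goes with
it. -/
def IsTop (S : Set (ℕ × ℕ)) (l m : ℕ) : Prop :=
  (∀ I ∈ S, I.2 ≤ l) ∧ (m, l) ∈ S ∧ ∀ a, (a, l) ∈ S → m ≤ a

/-- The effect of `step` on the set of intervals. -/
def stepSet (S : Set (ℕ × ℕ)) (l m i : ℕ) : Set (ℕ × ℕ) :=
  if i ≤ m then insert (i, l) S
  else if i ≤ l then insert (i, l + 1) (moveThree l i '' S)
  else insert (l + 1, l + 1) S

/-- No interval contains another one in its interior. -/
def NoNest (S : Set (ℕ × ℕ)) : Prop :=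
  ∀ a b c d, (a, b) ∈ S → (c, d) ∈ S → a < c → b ≤ d

/-- Every number up to the largest right endpoint is both a left and a right endpoint. -/
def IsFull (R : List (ℕ × ℕ)) : Prop :=
  R ≠ [] ∧ (∀ I ∈ R, I.1 ≤ I.2) ∧
    ∀ v ≤ largestRight R, (∃ I ∈ R, I.1 = v) ∧ ∃ I ∈ R, I.2 = v

theorem le_largestRight {R : List (ℕ × ℕ)} {I : ℕ × ℕ} (h : I ∈ R) : I.2 ≤ largestRight R := by
  induction R with
  | nil => simp at h
  | cons J R ih =>
    simp only [largestRight, List.map_cons, List.foldr_cons] at ih ⊢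
    rcases List.mem_cons.1 h with rfl | h
    · exact le_max_left _ _
    · exact (ih h).trans (le_max_right _ _)

theorem exists_largestRight {R : List (ℕ × ℕ)} (h : R ≠ []) : ∃ I ∈ R, I.2 = largestRight R := by
  induction R with
  | nil => simp at h
  | cons J R ih =>
    rcases eq_or_ne R [] with rfl | hR
    · exact ⟨J, by simp, by simp [largestRight]⟩
    · obtain ⟨I, hI, h2⟩ := ih hR
      simp only [largestRight, List.map_cons, List.foldr_cons] at h2 ⊢
      rcases le_total J.2 ((R.map Prod.snd).foldr max 0) with h3 | h3
      · exact ⟨I, List.mem_cons_of_mem _ hI, by rw [max_eq_right h3, h2]⟩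
      · exact ⟨J, by simp, by rw [max_eq_left h3]⟩

theorem largestRight_eq {R : List (ℕ × ℕ)} {l : ℕ} (h1 : ∀ I ∈ R, I.2 ≤ l)
    (h2 : ∃ I ∈ R, I.2 = l) : largestRight R = l := by
  obtain ⟨I, hI, rfl⟩ := h2
  obtain ⟨J, hJ, h⟩ := exists_largestRight (List.ne_nil_of_mem hI)
  exact le_antisymm (h ▸ h1 J hJ) (le_largestRight hI)

theorem isTop_list {R : List (ℕ × ℕ)} (h : R ≠ []) :
    IsTop {I | I ∈ R} (largestRight R) (smallestLeft R) := by
  set L := (R.filter (fun I => I.2 = largestRight R)).map Prod.fst with hL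
  have hmem : ∀ a, a ∈ L ↔ (a, largestRight R) ∈ R := by
    intro a
    simp only [hL, List.mem_map, List.mem_filter, decide_eq_true_eq, Prod.exists]
    constructor
    · rintro ⟨a, b, ⟨h, rfl⟩, rfl⟩
      exact h
    · exact fun h => ⟨a, _, ⟨h, rfl⟩, rfl⟩
  obtain ⟨⟨a, b⟩, hI, h2⟩ := exists_largestRight h
  obtain rfl : b = largestRight R := h2
  have hne : L ≠ [] := List.ne_nil_of_mem ((hmem a).2 hI)
  have hs : L.min? = some (smallestLeft R) := by
    obtain ⟨m, hm⟩ := Option.isSome_iff_exists.1 (List.isSome_min?_of_ne_nil hne)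
    rw [smallestLeft, ← hL, hm]
    rfl
  rw [List.min?_eq_some_iff] at hs
  exact ⟨fun I hI => le_largestRight hI, (hmem _).1 hs.1, fun a ha => hs.2 a ((hmem a).2 ha)⟩

theorem IsTop.unique {S : Set (ℕ × ℕ)} {l m l' m' : ℕ} (h : IsTop S l m) (h' : IsTop S l' m') :
    l = l' ∧ m = m' := by
  obtain rfl : l = l' := le_antisymm (h'.1 _ h.2.1) (h.1 _ h'.2.1)
  exact ⟨rfl, le_antisymm (h.2.2 _ h'.2.1) (h'.2.2 _ h.2.1)⟩

theorem setOf_mem_step (R : List (ℕ × ℕ)) (i : ℕ) :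
    {I | I ∈ step R i} = stepSet {I | I ∈ R} (largestRight R) (smallestLeft R) i := by
  unfold step stepSet
  split_ifs
  · ext I; simp
  · ext I; simp
  · ext I; simp

theorem step_ne_nil (R : List (ℕ × ℕ)) (i : ℕ) : step R i ≠ [] := by
  unfold step
  split_ifs <;> simp

/-- In the third move, endpoints below i stay, those from i on shift up by one, and the gap at i is
filled on the left by the new interval and on the right by the truncated intervals. -/
theorem IsFull.step {R : List (ℕ × ℕ)} (h : IsFull R) (i : ℕ) : IsFull (step R i) := by
  obtain ⟨hne, hle, hv⟩ := h
  obtain ⟨hl, hm, -⟩ := isTop_list hne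
  refine ⟨step_ne_nil R i, ?_⟩
  unfold HereditarySemiorder.step
  generalize largestRight R = l at *
  generalize smallestLeft R = m at *
  have hml : m ≤ l := hle _ hm
  split_ifs with h1 h2
  · have : largestRight ((i, l) :: R) = l :=
      largestRight_eq (by simpa using fun a b h => hl (a, b) h) ⟨_, List.mem_cons_self, rfl⟩
    rw [this]
    refine ⟨?_, fun v hvl => ?_⟩
    · intro I hI
      rcases List.mem_cons.1 hI with rfl | hI
      · exact h1.trans hml
      · exact hle I hI
    · obtain ⟨⟨I, hI, h3⟩, J, hJ, h4⟩ := hv v hvl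
      exact ⟨⟨I, List.mem_cons_of_mem _ hI, h3⟩, J, List.mem_cons_of_mem _ hJ, h4⟩
  · have : largestRight ((i, l + 1) :: R.map (moveThree l i)) = l + 1 := by
      refine largestRight_eq (fun I hI => ?_) ⟨_, List.mem_cons_self, rfl⟩
      rcases List.mem_cons.1 hI with rfl | hI
      · exact le_rfl
      · obtain ⟨J, hJ, rfl⟩ := List.mem_map.1 hI
        have := hl J hJ
        unfold moveThree
        split_ifs <;> (try dsimp only) <;> omega
    rw [this]
    have key : ∀ {J : ℕ × ℕ}, J ∈ R →
        moveThree l i J ∈ (i, l + 1) :: R.map (moveThree l i) :=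
      fun hJ => List.mem_cons_of_mem _ (List.mem_map_of_mem hJ)
    refine ⟨?_, fun v hvl => ⟨?_, ?_⟩⟩
    · intro I hI
      rcases List.mem_cons.1 hI with rfl | hI
      · simp; omega
      · obtain ⟨J, hJ, rfl⟩ := List.mem_map.1 hI
        have := hle J hJ
        unfold moveThree
        split_ifs <;> (try dsimp only) <;> omega
    · rcases lt_trichotomy v i with h3 | rfl | h3
      · obtain ⟨⟨I, hI, h4⟩, -⟩ := hv v (by omega)
        refine ⟨_, key hI, ?_⟩
        unfold moveThree
        split_ifs <;> (try dsimp only) <;> omega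
      · exact ⟨_, List.mem_cons_self, rfl⟩
      · obtain ⟨⟨I, hI, h4⟩, -⟩ := hv (v - 1) (by omega)
        refine ⟨_, key hI, ?_⟩
        unfold moveThree
        split_ifs <;> (try dsimp only) <;> omega
    · rcases lt_trichotomy v i with h3 | rfl | h3
      · obtain ⟨-, I, hI, h4⟩ := hv v (by omega)
        have := hle I hI
        refine ⟨_, key hI, ?_⟩
        unfold moveThree
        split_ifs <;> (try dsimp only) <;> omega
      -- The interval [m, l] has m < i, so it is cut to [m, i].
      · refine ⟨_, key hm, ?_⟩
        unfold moveThree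
        split_ifs <;> simp_all
      · rcases hvl.eq_or_lt with rfl | h5
        · exact ⟨_, List.mem_cons_self, rfl⟩
        obtain ⟨-, I, hI, h4⟩ := hv (v - 1) (by omega)
        have := hle I hI
        refine ⟨_, key hI, ?_⟩
        unfold moveThree
        split_ifs <;> (try dsimp only) <;> omega
  · have : largestRight ((l + 1, l + 1) :: R) = l + 1 := by
      refine largestRight_eq (fun I hI => ?_) ⟨_, List.mem_cons_self, rfl⟩
      rcases List.mem_cons.1 hI with rfl | hI
      · exact le_rfl
      · exact (hl I hI).trans (Nat.le_succ l)
    rw [this]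
    refine ⟨?_, fun v hvl => ?_⟩
    · intro I hI
      rcases List.mem_cons.1 hI with rfl | hI
      · exact le_rfl
      · exact hle I hI
    · rcases hvl.eq_or_lt with rfl | h5
      · exact ⟨⟨_, List.mem_cons_self, rfl⟩, _, List.mem_cons_self, rfl⟩
      obtain ⟨⟨I, hI, h3⟩, J, hJ, h4⟩ := hv v (by omega)
      exact ⟨⟨I, List.mem_cons_of_mem _ hI, h3⟩, J, List.mem_cons_of_mem _ hJ, h4⟩

theorem IsFull.foldl_step {R : List (ℕ × ℕ)} (h : IsFull R) (x : List ℕ) :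
    IsFull (x.foldl HereditarySemiorder.step R) := by
  induction x generalizing R with
  | nil => exact h
  | cons i x ih => exact ih (h.step i)

theorem isFull_singleton : IsFull [(0, 0)] := by
  simp [IsFull, largestRight]

theorem isFull_intervalsOfSeq {x : List ℕ} (hx : x ≠ []) : IsFull (intervalsOfSeq x) := by
  cases x with
  | nil => exact absurd rfl hx
  | cons a x => exact isFull_singleton.foldl_step x

/-- If [c, d] lay inside [a, b], fullness would supply an interval ending at c - 1 and one starting
at d + 1. With [c, d] they form a three-element chain incomparable to [a, b], which equal lengths
forbid. -/
theorem IsFull.noNest {R : List (ℕ × ℕ)} (h : IsFull R) (hs : IsSemiorder (precedes R)) :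
    NoNest {I | I ∈ R} := by
  obtain ⟨-, hle, hv⟩ := h
  obtain ⟨left, right, ⟨-, hr⟩, w, hw⟩ := hs
  intro a b c d hab hcd hac
  by_contra! hdb
  have hl := le_largestRight hab
  have hcd' := hle _ hcd
  simp only at hl hcd'
  obtain ⟨-, I, hI, h1⟩ := hv (c - 1) (by omega)
  obtain ⟨⟨J, hJ, h2⟩, -⟩ := hv (d + 1) (by omega)
  obtain ⟨u, rfl⟩ := List.get_of_mem hI
  obtain ⟨z, rfl⟩ := List.get_of_mem hJ
  obtain ⟨x, hx⟩ := List.get_of_mem hab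
  obtain ⟨y, hy⟩ := List.get_of_mem hcd
  have e1 := (hr u y).1 (by simp only [precedes, hy]; omega)
  have e2 := (hr y z).1 (by simp only [precedes, hy]; omega)
  have e3 := mt (hr u x).2 (by simp only [precedes, hx]; omega)
  have e4 := mt (hr x z).2 (by simp only [precedes, hx]; omega)
  have := hw x
  have := hw y
  push Not at e3 e4
  linarith

/-! ### Recognising the minimal endpoint representation -/

/-- Down sets are ordered strictly as left endpoints: an element with right endpoint v separates the
down set for left endpoint v from every larger one. Since all left endpoints up to l occur, exactly
(f x).1 down sets lie strictly below that of x. Up sets are dual. -/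
theorem minEndpointInterval_eq {α : Type*} [PartialOrder α] {f : α → ℕ × ℕ}
    (hf : ∀ x y, x < y ↔ (f x).2 < (f y).1) {l : ℕ} (hfl : ∀ x, (f x).2 ≤ l)
    (hle : ∀ x, (f x).1 ≤ (f x).2) (h1 : ∀ v ≤ l, ∃ x, (f x).1 = v)
    (h2 : ∀ v ≤ l, ∃ x, (f x).2 = v) (x : α) : minEndpointInterval x = f x := by
  have hD : ∀ y z : α, Set.Iio y ⊂ Set.Iio z ↔ (f y).1 < (f z).1 := by
    intro y z
    have := hle z
    have := hfl z
    rw [ssubset_iff_subset_not_subset]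
    constructor
    · rintro ⟨-, h⟩
      by_contra! hc
      exact h fun t ht => (hf _ _).2 (((hf _ _).1 ht).trans_le hc)
    · intro h
      refine ⟨fun t ht => (hf _ _).2 (((hf _ _).1 ht).trans h), fun hc => ?_⟩
      obtain ⟨t, ht⟩ := h2 (f y).1 (by omega)
      have := (hf _ _).1 (hc ((hf t z).2 (by omega)))
      omega
  have hU : ∀ y z : α, Set.Ioi z ⊂ Set.Ioi y ↔ (f y).2 < (f z).2 := by
    intro y z
    have := hle y
    have := hfl z
    rw [ssubset_iff_subset_not_subset]
    constructor
    · rintro ⟨-, h⟩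
      by_contra! hc
      exact h fun t ht => (hf _ _).2 (hc.trans_lt ((hf _ _).1 ht))
    · intro h
      refine ⟨fun t ht => (hf _ _).2 (h.trans ((hf _ _).1 ht)), fun hc => ?_⟩
      obtain ⟨t, ht⟩ := h1 (f z).2 (by omega)
      have := (hf _ _).1 (hc ((hf y t).2 (by omega)))
      omega
  have hD' : ∀ y z : α, (f y).1 = (f z).1 → Set.Iio y = Set.Iio z := by
    intro y z h
    ext t
    simp only [Set.mem_Iio, hf, h]
  have hU' : ∀ y z : α, (f y).2 = (f z).2 → Set.Ioi y = Set.Ioi z := by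
    intro y z h
    ext t
    simp only [Set.mem_Ioi, hf, h]
  have : Nonempty α := ⟨x⟩
  choose! g hg using h1
  choose! k hk using h2
  have := hle x
  have := hfl x
  refine Prod.ext ?_ ?_
  · have : {D : Set α | (∃ y, D = Set.Iio y) ∧ D ⊂ Set.Iio x} =
        (fun v => Set.Iio (g v)) '' Set.Iio (f x).1 := by
      ext D
      constructor
      · rintro ⟨⟨y, rfl⟩, h⟩
        rw [hD] at h
        exact ⟨(f y).1, h, hD' _ _ (hg _ (by omega))⟩
      · rintro ⟨v, hv, rfl⟩
        have hv' : v < (f x).1 := hv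
        exact ⟨⟨_, rfl⟩, (hD _ _).2 (by rw [hg v (by omega)]; exact hv)⟩
    simp only [minEndpointInterval, this]
    rw [Set.InjOn.ncard_image]
    · simp [Set.ncard_eq_toFinset_card']
    · intro v hv w hw h
      have hv' : v < (f x).1 := hv
      have hw' : w < (f x).1 := hw
      by_contra hne
      rcases lt_or_gt_of_ne hne with h3 | h3
      · exact ((hD (g v) (g w)).2 (by rw [hg v (by omega), hg w (by omega)]; exact h3)).ne h
      · exact ((hD (g w) (g v)).2 (by rw [hg v (by omega), hg w (by omega)]; exact h3)).ne h.symm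
  · have : {U : Set α | (∃ y, U = Set.Ioi y) ∧ Set.Ioi x ⊂ U} =
        (fun v => Set.Ioi (k v)) '' Set.Iio (f x).2 := by
      ext D
      constructor
      · rintro ⟨⟨y, rfl⟩, h⟩
        rw [hU] at h
        exact ⟨(f y).2, h, hU' _ _ (hk _ (by omega))⟩
      · rintro ⟨v, hv, rfl⟩
        have hv' : v < (f x).2 := hv
        exact ⟨⟨_, rfl⟩, (hU _ _).2 (by rw [hk v (by omega)]; exact hv)⟩
    simp only [minEndpointInterval, this]
    rw [Set.InjOn.ncard_image]
    · simp [Set.ncard_eq_toFinset_card']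
    · intro v hv w hw h
      have hv' : v < (f x).2 := hv
      have hw' : w < (f x).2 := hw
      by_contra hne
      rcases lt_or_gt_of_ne hne with h3 | h3
      · exact ((hU (k v) (k w)).2 (by rw [hk v (by omega), hk w (by omega)]; exact h3)).ne h.symm
      · exact ((hU (k w) (k v)).2 (by rw [hk v (by omega), hk w (by omega)]; exact h3)).ne h

theorem IsFull.minEndpointIntervals_eq {α : Type*} [PartialOrder α] {R : List (ℕ × ℕ)}
    (h : IsFull R) (e : (fun a b : α => a < b) ≃r precedes R) :
    minEndpointIntervals α = {I | I ∈ R} := by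
  obtain ⟨-, hle, hv⟩ := h
  have hsurj : ∀ I ∈ R, ∃ x, R.get (e x) = I := by
    intro I hI
    obtain ⟨n, hn⟩ := List.get_of_mem hI
    exact ⟨e.symm n, by rw [e.apply_symm_apply, hn]⟩
  have key : ∀ x : α, minEndpointInterval x = R.get (e x) :=
    minEndpointInterval_eq (fun x y => e.map_rel_iff.symm)
      (fun x => le_largestRight (List.get_mem _ _)) (fun x => hle _ (List.get_mem _ _))
      (fun v hvl => by
        obtain ⟨⟨I, hI, h⟩, -⟩ := hv v hvl
        obtain ⟨x, hx⟩ := hsurj I hI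
        exact ⟨x, by rw [hx, h]⟩)
      (fun v hvl => by
        obtain ⟨-, I, hI, h⟩ := hv v hvl
        obtain ⟨x, hx⟩ := hsurj I hI
        exact ⟨x, by rw [hx, h]⟩)
  ext I
  constructor
  · rintro ⟨x, rfl⟩
    rw [key]
    exact List.get_mem _ _
  · intro hI
    obtain ⟨x, hx⟩ := hsurj I hI
    exact ⟨x, by rw [key, hx]⟩

/-! ### Chains of blocks -/

theorem Block.one_le_size (B : Block) : 1 ≤ B.size := by
  cases B <;> simp [Block.size] <;> omega

theorem Block.IsCOrU.two_le_size {B : Block} (h : B.IsCOrU) : 2 ≤ B.size := by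
  cases B <;> simp_all [Block.size, Block.IsCOrU] <;> omega

theorem mem_uIntervals {b k x y : ℕ} (hk : 1 ≤ k) : (x, y) ∈ uIntervals b k ↔
    (x = b ∧ b ≤ y ∧ y < b + k) ∨ (y = b + k ∧ b < x ∧ x ≤ b + k) := by
  simp only [uIntervals, Set.mem_ofPred_eq, Prod.mk.injEq]
  constructor
  · rintro ⟨i, hi, h | h⟩ <;> omega
  · rintro (h | h)
    · exact ⟨y - b, by omega, by omega⟩
    · exact ⟨b + k - x, by omega, by omega⟩

/-- Membership in the intervals of a block, in terms of linear arithmetic. -/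
def Block.Mem (b x y : ℕ) : Block → Prop
  | .T1 => (x = b ∧ y = b) ∨ (x = b + 1 ∧ y = b + 1)
  | .W k _ => (x = b ∧ y = b) ∨ (x = b + k ∧ y = b + k) ∨ (b ≤ x ∧ x < b + k ∧ y = x + 1)
  | .C2 => (x = b ∧ b ≤ y ∧ y ≤ b + 2) ∨ (y = b + 2 ∧ b < x ∧ x ≤ b + 2)
  | .U k _ => (x = b ∧ b ≤ y ∧ y < b + k) ∨ (y = b + k ∧ b < x ∧ x ≤ b + k)
  | .C k _ => (x = b ∧ b ≤ y ∧ y ≤ b + k) ∨ (y = b + k ∧ b < x ∧ x ≤ b + k)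

theorem Block.mem_intervals {B : Block} {b x y : ℕ} : (x, y) ∈ B.intervals b ↔ B.Mem b x y := by
  cases B with
  | T1 => simp [Block.intervals, Block.Mem]
  | W k hk =>
    simp only [Block.intervals, Block.Mem, Set.mem_union, Set.mem_insert_iff,
      Set.mem_singleton_iff, Set.mem_ofPred_eq, Prod.mk.injEq]
    constructor
    · rintro ((h | h) | ⟨i, hi, h⟩) <;> omega
    · rintro (h | h | h)
      · exact Or.inl (Or.inl h)
      · exact Or.inl (Or.inr h)
      · exact Or.inr ⟨x - b, by omega, by omega⟩
  | C2 =>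
    simp only [Block.intervals, Block.Mem, Set.mem_insert_iff, Set.mem_singleton_iff,
      Prod.mk.injEq]
    omega
  | U k hk => simp only [Block.intervals, Block.Mem, mem_uIntervals (by omega : 1 ≤ k)]
  | C k hk =>
    simp only [Block.intervals, Block.Mem, mem_uIntervals (by omega : 1 ≤ k), Set.mem_union,
      Set.mem_singleton_iff, Prod.mk.injEq]
    omega

/-- Membership in a join. -/
def Boundary.Mem (p x y : ℕ) : Boundary → Prop → Prop
  | .strong, P => P
  | .weak, P => P ∧ ¬ (x = p ∧ y = p)
  | .weakOptional, P => (P ∧ ¬ (x = p ∧ y = p)) ∨ (x = p - 1 ∧ y = p + 1)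

theorem Boundary.mem_join {β : Boundary} {p x y : ℕ} {X Y : Set (ℕ × ℕ)} :
    (x, y) ∈ β.join p X Y ↔ β.Mem p x y ((x, y) ∈ X ∨ (x, y) ∈ Y) := by
  cases β <;> simp [Boundary.join, Boundary.Mem, or_comm]

theorem Block.Mem.bounds {B : Block} {b x y : ℕ} (h : B.Mem b x y) :
    b ≤ x ∧ x ≤ y ∧ y ≤ b + B.size := by
  cases B <;> simp only [Block.Mem, Block.size] at * <;> omega

theorem Block.mem_last (B : Block) (b : ℕ) : B.Mem b (b + B.size) (b + B.size) := by
  cases B <;> simp only [Block.Mem, Block.size, true_and, true_or, or_true] at * <;> omega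

theorem Block.mem_first (B : Block) (b : ℕ) : B.Mem b b b := by
  cases B <;> simp only [Block.Mem, true_and, true_or] at * <;> omega

/-! ### Chains grown at their right end -/

/-- `Chain B p S`: some permitted chain that starts at `0` describes `S`, and its last block is
`B`, placed at `p`. -/
inductive Chain : Block → ℕ → Set (ℕ × ℕ) → Prop
  | single (B : Block) : Chain B 0 (B.intervals 0)
  | snoc {A B : Block} {q : ℕ} {X : Set (ℕ × ℕ)} (β : Boundary) (h : Chain A q X)
      (hβ : β.Permitted A B) :
      Chain B (q + A.size) (β.join (q + A.size) X (B.intervals (q + A.size)))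

/-- The total size of the blocks of a chain. -/
def chainSize (A : Block) : List (Boundary × Block) → ℕ
  | [] => A.size
  | (_, B) :: rest => A.size + chainSize B rest

/-- The last block of a chain. -/
def chainLast (A : Block) : List (Boundary × Block) → Block
  | [] => A
  | (_, B) :: rest => chainLast B rest

theorem chainPermitted_snoc {A : Block} {rest : List (Boundary × Block)} {β : Boundary}
    {B : Block} (h : ChainPermitted A rest) (hβ : β.Permitted (chainLast A rest) B) :
    ChainPermitted A (rest ++ [(β, B)]) := by
  induction rest generalizing A with
  | nil => exact ⟨hβ, trivial⟩
  | cons c rest ih => exact ⟨h.1, ih h.2 hβ⟩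

theorem one_le_chainSize (A : Block) (rest : List (Boundary × Block)) :
    1 ≤ chainSize A rest := by
  cases rest with
  | nil => exact A.one_le_size
  | cons c rest => exact A.one_le_size.trans (Nat.le_add_right _ _)

/-- Joining is associative as long as the point interval removed at one boundary does not come from
the block beyond the other. This converts chains nested to the right into chains extended at the
right end. -/
theorem join_join {β γ : Boundary} {p q : ℕ} {X Y Z : Set (ℕ × ℕ)} (hpq : p < q)
    (hX : (q, q) ∉ X) (hZ : (p, p) ∉ Z) :
    β.join p X (γ.join q Y Z) = γ.join q (β.join p X Y) Z := by
  ext ⟨x, y⟩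
  simp only [Boundary.mem_join]
  cases β <;> cases γ <;> simp only [Boundary.Mem] <;> grind

theorem chainIntervals_snoc (b : ℕ) (A : Block) (rest : List (Boundary × Block)) (β : Boundary)
    (B : Block) : chainIntervals b A (rest ++ [(β, B)]) =
      β.join (b + chainSize A rest) (chainIntervals b A rest)
        (B.intervals (b + chainSize A rest)) := by
  induction rest generalizing A b with
  | nil => rfl
  | cons c rest ih =>
    obtain ⟨γ, C⟩ := c
    simp only [List.cons_append, chainIntervals, chainSize]
    have := one_le_chainSize C rest
    rw [ih, ← add_assoc, join_join]
    · omega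
    · rw [Block.mem_intervals]
      exact fun h => by have := h.bounds; omega
    · rw [Block.mem_intervals]
      exact fun h => by have := h.bounds; omega

theorem Chain.exists_blockStructure {B : Block} {p : ℕ} {S : Set (ℕ × ℕ)} (h : Chain B p S) :
    ∃ A rest, ChainPermitted A rest ∧ chainLast A rest = B ∧
      chainSize A rest = p + B.size ∧ chainIntervals 0 A rest = S := by
  induction h with
  | single B => exact ⟨B, [], trivial, rfl, by simp [chainSize], rfl⟩
  | @snoc A B q X β h hβ ih =>
    obtain ⟨A', rest, h1, rfl, h3, rfl⟩ := ih
    refine ⟨A', rest ++ [(β, B)], chainPermitted_snoc h1 hβ, ?_, ?_, ?_⟩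
    · clear h1 h3 hβ h
      induction rest generalizing A' with
      | nil => rfl
      | cons c rest ih => exact ih _
    · rw [← h3]
      clear h1 h3 hβ h
      induction rest generalizing A' with
      | nil => rfl
      | cons c rest ih =>
        obtain ⟨γ, C⟩ := c
        simp only [chainSize, List.cons_append, ih, add_assoc]
    · rw [chainIntervals_snoc, h3, zero_add]

theorem Boundary.Mem.of_true {β : Boundary} {p x y : ℕ} {P : Prop} (h : P) (hp : x ≠ p ∨ y ≠ p) :
    β.Mem p x y P := by
  cases β
  · exact h
  · exact ⟨h, by omega⟩
  · exact Or.inl ⟨h, by omega⟩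

theorem Boundary.Mem.elim {β : Boundary} {p x y : ℕ} {P : Prop} (h : β.Mem p x y P) :
    P ∨ (x = p - 1 ∧ y = p + 1) := by
  cases β
  · exact Or.inl h
  · exact Or.inl h.1
  · exact h.imp_left And.left

/-- What the blocks before the last one look like from there: `X` ends at `p`. -/
structure EndsAt (X : Set (ℕ × ℕ)) (A : Block) (p : ℕ) : Prop where
  le : ∀ x y, (x, y) ∈ X → x ≤ y ∧ y ≤ p
  pos : 1 ≤ p
  last : (p, p) ∈ X
  short : ¬ A.IsT → (p - 1, p) ∈ X
  long : A.IsCOrU → ∃ a, a + 2 ≤ p ∧ (a, p) ∈ X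

theorem Chain.endsAt {B : Block} {p : ℕ} {S : Set (ℕ × ℕ)} (h : Chain B p S) :
    EndsAt S B (p + B.size) := by
  have short : ∀ p, ¬ B.IsT → B.Mem p (p + B.size - 1) (p + B.size) := by
    intro p h
    cases B <;> simp only [Block.Mem, Block.size, Block.IsT, not_true, true_and] at * <;> omega
  have long : ∀ p, B.IsCOrU → ∃ a, a + 2 ≤ p + B.size ∧ B.Mem p a (p + B.size) := by
    intro p h
    cases B <;> simp only [Block.IsCOrU, Block.size] at *
    · exact ⟨p, le_rfl, by simp only [Block.Mem, true_and]; omega⟩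
    · exact ⟨p + 1, by omega, by simp only [Block.Mem, true_and]; omega⟩
    · exact ⟨p, by omega, by simp only [Block.Mem, true_and]; omega⟩
  have hB := B.one_le_size
  induction h with
  | single B =>
    refine ⟨fun x y h => ?_, by omega, ?_, fun h => ?_, fun h => ?_⟩
    · have := (Block.mem_intervals.1 h).bounds
      omega
    · exact Block.mem_intervals.2 (B.mem_last 0)
    · exact Block.mem_intervals.2 (short 0 h)
    · obtain ⟨a, ha, h⟩ := long 0 h
      exact ⟨a, ha, Block.mem_intervals.2 h⟩
  | @snoc A B q X β h hβ ih =>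
    clear ih
    have hX : ∀ x y, (x, y) ∈ X → x ≤ y ∧ y ≤ q + A.size := by
      clear short long hβ hB
      induction h with
      | single B =>
        intro x y h
        have := (Block.mem_intervals.1 h).bounds
        omega
      | @snoc A B q X β h hβ ih =>
        intro x y h
        have := B.one_le_size
        rcases (Boundary.mem_join.1 h).elim with (h | h) | h
        · have := ih x y h
          omega
        · have := (Block.mem_intervals.1 h).bounds
          omega
        · omega
    refine ⟨fun x y h => ?_, by omega, ?_, fun h => ?_, fun h => ?_⟩
    · rcases (Boundary.mem_join.1 h).elim with (h | h) | h
      · have := hX x y h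
        omega
      · have := (Block.mem_intervals.1 h).bounds
        omega
      · omega
    · exact Boundary.mem_join.2 (.of_true (Or.inr (Block.mem_intervals.2 (B.mem_last _)))
        (by omega))
    · exact Boundary.mem_join.2 (.of_true (Or.inr (Block.mem_intervals.2 (short _ h)))
        (by omega))
    · obtain ⟨a, ha, h⟩ := long (q + A.size) h
      exact ⟨a, ha, Boundary.mem_join.2 (.of_true (Or.inr (Block.mem_intervals.2 h))
        (by omega))⟩

/-- The last block `B` of a chain `S`, what precedes it, and by what it can be replaced. -/
structure IsPrefix (S X : Set (ℕ × ℕ)) (p : ℕ) (β : Boundary) (B : Block) : Prop where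
  eq : S = β.join p X (B.intervals p)
  le : ∀ x y, (x, y) ∈ X → x ≤ y ∧ y ≤ p
  -- A weak boundary tolerates no `T1` and not two `W`s, so `B'` may be a `W` only where `B` already
  -- is one; an optional interval restricts `B'` further.
  replace : ∀ B' : Block, (β ≠ .strong → ¬ B'.IsT ∧ (B'.IsW → B.IsW)) →
    (β = .weakOptional → B'.IsW ∨ B'.IsC2) → Chain B' p (β.join p X (B'.intervals p))
  short : β ≠ .strong → 1 ≤ p ∧ (p - 1, p) ∈ X ∧ ¬ B.IsT
  optional : β = .weakOptional → B.IsW ∨ B.IsC2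
  -- In both cases the preceding block is a 𝒞 or 𝒰: it has an interval of length at least 2 ending
  -- at p, and it allows the optional interval.
  long : β = .weakOptional ∨ (β = .weak ∧ B.IsW) → (∃ a, a + 2 ≤ p ∧ (a, p) ∈ X) ∧
    Chain B p (Boundary.weakOptional.join p X (B.intervals p))

theorem Block.IsCOrU.not_isT {B : Block} (h : B.IsCOrU) : ¬ B.IsT := by
  cases B <;> simp_all [Block.IsCOrU, Block.IsT]

theorem Block.isCOrU_of_not {B : Block} (hT : ¬ B.IsT) (hW : ¬ B.IsW) : B.IsCOrU := by
  cases B <;> simp_all [Block.IsCOrU, Block.IsT, Block.IsW]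

theorem Block.not_isT_of_isW_or {B : Block} (h : B.IsW ∨ B.IsC2) : ¬ B.IsT := by
  cases B <;> simp_all [Block.IsC2, Block.IsT, Block.IsW]

/-- A first block counts as strongly joined to the empty set, so the case analysis below need not
distinguish it. -/
theorem Chain.exists_prefix {B : Block} {p : ℕ} {S : Set (ℕ × ℕ)} (h : Chain B p S) :
    ∃ X β, IsPrefix S X p β B := by
  cases h with
  | single =>
    refine ⟨∅, .strong, by simp [Boundary.join], by simp, fun B' _ _ => ?_, by simp, by simp,
      by simp⟩
    simpa [Boundary.join] using Chain.single B'
  | @snoc A _ q X β h hβ =>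
    have hA := h.endsAt
    refine ⟨X, β, rfl, hA.le, fun B' h1 h2 => h.snoc β ?_, fun hs => ?_, fun ho => ?_,
      fun ho => ?_⟩
    · cases β with
      | strong => trivial
      | weak =>
        obtain ⟨h3, h4⟩ := h1 (by simp)
        exact ⟨hβ.1, h3, fun h5 => hβ.2.2 ⟨h5.1, h4 h5.2⟩⟩
      | weakOptional => exact ⟨hβ.1, h2 rfl⟩
    · refine ⟨hA.pos, hA.short ?_, ?_⟩
      · cases β with
        | strong => exact absurd rfl hs
        | weak => exact hβ.1
        | weakOptional => exact hβ.1.not_isT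
      · cases β with
        | strong => exact absurd rfl hs
        | weak => exact hβ.2.1
        | weakOptional => exact Block.not_isT_of_isW_or hβ.2
    · subst ho
      exact hβ.2
    · have : A.IsCOrU ∧ (B.IsW ∨ B.IsC2) := by
        rcases ho with rfl | ⟨rfl, hW⟩
        · exact hβ
        · exact ⟨Block.isCOrU_of_not hβ.1 fun h => hβ.2.2 ⟨h, hW⟩, Or.inl hW⟩
      exact ⟨hA.long this.1, h.snoc .weakOptional this⟩

/-! ### Appending a term to the ascent sequence -/

/-- Inverts the move, one disjunct per fate of an interval: shifted, truncated to i, stretched,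
unchanged. The bound y ≤ l on stretched intervals reflects that those ending at l are truncated
instead. -/
theorem mem_image_moveThree {S : Set (ℕ × ℕ)} {l i x y : ℕ} (hS : ∀ I ∈ S, I.2 ≤ l)
    (hi : i ≤ l) : (x, y) ∈ moveThree l i '' S ↔
      (i < x ∧ 1 ≤ y ∧ (x - 1, y - 1) ∈ S) ∨ (x < i ∧ y = i ∧ (x, l) ∈ S) ∨
        (x < i ∧ i < y ∧ y ≤ l ∧ (x, y - 1) ∈ S) ∨ (x < i ∧ y < i ∧ (x, y) ∈ S) := by
  constructor
  · rintro ⟨⟨a, b⟩, h, he⟩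
    have := hS _ h
    unfold moveThree at he
    dsimp only at he this
    split_ifs at he <;> obtain ⟨rfl, rfl⟩ := Prod.mk.inj he
    · exact Or.inl ⟨by omega, by omega, h⟩
    · subst b
      exact Or.inr (Or.inl ⟨by omega, rfl, h⟩)
    · exact Or.inr (Or.inr (Or.inl ⟨by omega, by omega, by omega, h⟩))
    · exact Or.inr (Or.inr (Or.inr ⟨by omega, by omega, h⟩))
  · rintro (⟨h1, h2, h⟩ | ⟨h1, rfl, h⟩ | ⟨h1, h2, h3, h⟩ | ⟨h1, h2, h⟩) <;>
      refine ⟨_, h, ?_⟩ <;> unfold moveThree <;> grind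

section

variable {B : Block} {p l m i : ℕ} {S : Set (ℕ × ℕ)}

theorem Chain.eq_end (h : Chain B p S) (ht : IsTop S l m) : l = p + B.size :=
  le_antisymm (h.endsAt.le _ _ ht.2.1).2 (ht.1 _ h.endsAt.last)

theorem mem_stepSet_low (hi : i ≤ m) {x y : ℕ} :
    (x, y) ∈ stepSet S l m i ↔ (x = i ∧ y = l) ∨ (x, y) ∈ S := by
  simp [stepSet, hi]

theorem mem_stepSet_mid (ht : IsTop S l m) (hm : m < i) (hi : i ≤ l) {x y : ℕ} :
    (x, y) ∈ stepSet S l m i ↔ (x = i ∧ y = l + 1) ∨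
      (i < x ∧ 1 ≤ y ∧ (x - 1, y - 1) ∈ S) ∨ (x < i ∧ y = i ∧ (x, l) ∈ S) ∨
        (x < i ∧ i < y ∧ y ≤ l ∧ (x, y - 1) ∈ S) ∨ (x < i ∧ y < i ∧ (x, y) ∈ S) := by
  rw [stepSet, if_neg (by omega), if_pos hi, Set.mem_insert_iff, mem_image_moveThree ht.1 hi,
    Prod.mk.injEq]

theorem Chain.step_high (h : Chain B p S) (ht : IsTop S l m) (hm : m < i) (hi : l < i) :
    ∃ B' p', Chain B' p' (stepSet S l m i) := by
  have hl := h.eq_end ht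
  refine ⟨.T1, p + B.size, ?_⟩
  convert h.snoc (B := .T1) .strong trivial using 1
  have := h.endsAt.last
  rw [stepSet, if_neg (by omega), if_neg (by omega), ← hl]
  rw [← hl] at this
  ext I
  simp only [Boundary.join, Block.intervals, Set.mem_insert_iff, Set.mem_union,
    Set.mem_singleton_iff]
  grind

theorem stepSet_self (ht : IsTop S l m) : stepSet S l m m = S := by
  rw [stepSet, if_pos le_rfl, Set.insert_eq_of_mem ht.2.1]

/-- Inserting i = l moves [l, l] to [l + 1, l + 1], adds [l, l + 1] and fixes the rest: exactly a
weakly attached `W 1`. -/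
theorem Chain.step_top (h : Chain B p S) (hB : B.IsCOrU) (ht : IsTop S l m) (hm : m < l) :
    ∃ B' p', Chain B' p' (stepSet S l m l) := by
  have hl := h.eq_end ht
  refine ⟨.W 1 le_rfl, p + B.size, ?_⟩
  have hW : ¬ B.IsW := by cases B <;> simp_all [Block.IsCOrU, Block.IsW]
  convert h.snoc (B := .W 1 le_rfl) .weak ⟨hB.not_isT, by simp [Block.IsT], by simp [hW]⟩ using 1
  have h1 := h.endsAt.last
  have h2 := h.endsAt.le
  rw [← hl] at h1 h2 ⊢
  ext ⟨x, y⟩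
  rw [mem_stepSet_mid ht hm le_rfl, Boundary.mem_join, Block.mem_intervals]
  simp only [Boundary.Mem, Block.Mem]
  have h3 := h2 x y
  have h4 := h2 (x - 1) (y - 1)
  by_cases h5 : x = l
  · subst h5
    by_cases h6 : (x, y) ∈ S <;> grind
  · by_cases h6 : (x, y) ∈ S <;> by_cases h7 : y = l <;> grind

variable {X : Set (ℕ × ℕ)} {β : Boundary}

theorem IsPrefix.mem (h : IsPrefix S X p β B) {x y : ℕ} :
    (x, y) ∈ S ↔ β.Mem p x y ((x, y) ∈ X ∨ B.Mem p x y) := by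
  rw [h.eq, Boundary.mem_join, Block.mem_intervals]

theorem IsPrefix.mem_mid (hp : IsPrefix S X p β B) (ht : IsTop S l m) (hm : m < i) (hpi : p < i)
    (hi : i ≤ l) {x y : ℕ} :
    (x, y) ∈ stepSet S l m i ↔ (x = i ∧ y = l + 1) ∨
      (i < x ∧ 1 ≤ y ∧ B.Mem p (x - 1) (y - 1)) ∨
      (x < i ∧ y = i ∧ β.Mem p x l (B.Mem p x l)) ∨
      (x < i ∧ i < y ∧ y ≤ l ∧ β.Mem p x (y - 1) (B.Mem p x (y - 1))) ∨
      (x < i ∧ y < i ∧ β.Mem p x y ((x, y) ∈ X ∨ B.Mem p x y)) := by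
  rw [mem_stepSet_mid ht hm hi]
  have h1 : i < x → ((x - 1, y - 1) ∈ S ↔ B.Mem p (x - 1) (y - 1)) := by
    intro h
    have := hp.le (x - 1) (y - 1)
    rw [hp.mem]
    cases β <;> simp only [Boundary.Mem] <;> grind
  have h2 : (x, l) ∈ S ↔ β.Mem p x l (B.Mem p x l) := by
    have h : (x, l) ∉ X := fun h => by have := hp.le x l h; omega
    simp [hp.mem, h]
  have h3 : i < y → ((x, y - 1) ∈ S ↔ β.Mem p x (y - 1) (B.Mem p x (y - 1))) := by
    intro hiy
    have h : (x, y - 1) ∉ X := fun h => by have := hp.le x (y - 1) h; omega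
    simp [hp.mem, h]
  rw [h2, hp.mem (x := x) (y := y)]
  exact or_congr Iff.rfl (or_congr (and_congr_right fun h => and_congr_right fun _ => h1 h)
    (or_congr Iff.rfl (or_congr (and_congr_right fun _ => and_congr_right fun h =>
      and_congr_right fun _ => h3 h) Iff.rfl)))

theorem Boundary.mem_iff_of_lt {x y : ℕ} {P : Prop} (h : p < x) : β.Mem p x y P ↔ P := by
  cases β <;> simp only [Boundary.Mem] <;> grind

/-- If the last block `B` becomes `B'` under the third move, comparing the blocks suffices. -/
theorem IsPrefix.stepSet_eq (hp : IsPrefix S X p β B) (ht : IsTop S l m) (hm : m < i)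
    (hpi : p < i) (hi : i ≤ l) {B' : Block}
    (h1 : ∀ x y, i ≤ x → (B.Mem p x y ↔ B'.Mem p (x + 1) (y + 1)))
    (h2 : ∀ y, y = l + 1 ↔ B'.Mem p i y)
    (h3 : ∀ x, x < i → (β.Mem p x l (B.Mem p x l) ↔ β.Mem p x i (B'.Mem p x i)))
    (h4 : ∀ x y, x < i → i ≤ y → y < l →
      (β.Mem p x y (B.Mem p x y) ↔ β.Mem p x (y + 1) (B'.Mem p x (y + 1))))
    (h5 : ∀ x y, x < i → B'.Mem p x y → y ≤ l)
    (h6 : ∀ x y, x < i → y < i → (B.Mem p x y ↔ B'.Mem p x y)) :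
    stepSet S l m i = β.join p X (B'.intervals p) := by
  have hX := hp.le
  ext ⟨x, y⟩
  rw [hp.mem_mid ht hm hpi hi, Boundary.mem_join, Block.mem_intervals]
  have hXx : p < x ∨ p < y → (x, y) ∉ X := fun h1 h2 => by
    have := hX x y h2
    omega
  rcases lt_trichotomy x i with hx | rfl | hx
  · rcases lt_trichotomy y i with hy | rfl | hy
    · rw [← h6 x y hx hy]
      simp [hx, hy, hx.ne, hx.not_gt, hy.ne, hy.not_gt]
    · simp [hx, hx.ne, hx.not_gt, hXx (Or.inr hpi), h3 x hx]
    · rcases le_or_gt y l with hyl | hyl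
      · obtain ⟨z, rfl⟩ : ∃ z, y = z + 1 := ⟨y - 1, by omega⟩
        simp [hx, hx.ne, hx.not_gt, hy, hy.ne', hy.not_gt, hyl, hXx (Or.inr (hpi.trans hy)),
          h4 x z hx (by omega) (by omega)]
      · have hB : ¬ B'.Mem p x y := fun h => by
          have := h5 x y hx h
          omega
        simp only [hx, hx.ne, hx.not_gt, hy, hy.ne', hy.not_gt, hyl.not_ge,
          hXx (Or.inr (hpi.trans hy)), hB]
        cases β <;> simp [Boundary.Mem]
        omega
  · simp [Boundary.mem_iff_of_lt hpi, ← h2, hXx (Or.inl hpi)]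
  · have hpx := hpi.trans hx
    obtain ⟨x, rfl⟩ : ∃ z, x = z + 1 := ⟨x - 1, by omega⟩
    cases y with
    | zero =>
      have hB : ¬ B'.Mem p (x + 1) 0 := fun h => by
        have := h.bounds
        omega
      simp [Boundary.mem_iff_of_lt hpx, hB, hx.ne', hx.not_gt, hXx (Or.inl hpx)]
    | succ y =>
      simp [Boundary.mem_iff_of_lt hpx, hx, hx.ne', hx.not_gt, hXx (Or.inl hpx),
        h1 x y (by omega)]

/-! ### Transitions of the last block -/

theorem IsPrefix.step_T1 (hp : IsPrefix S X p β .T1) (h : Chain .T1 p S) (ht : IsTop S l m)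
    (hn : NoNest (stepSet S l m i)) : ∃ B' p', Chain B' p' (stepSet S l m i) := by
  have hl : l = p + 1 := h.eq_end ht
  subst hl
  have hβ : β = .strong := by
    by_contra hβ
    exact (hp.short hβ).2.2 trivial
  subst hβ
  have hS := @hp.mem
  simp only [Boundary.Mem, Block.Mem] at hS
  have hX := hp.le
  have hm : m = p + 1 := by
    have := hS.1 ht.2.1
    have := hX m (p + 1)
    grind
  subst hm
  rcases lt_or_ge (p + 1) i with hi | hi
  · exact h.step_high ht hi hi
  rcases hi.eq_or_lt with rfl | hi
  · exact ⟨_, _, by rwa [stepSet_self ht]⟩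
  rcases (Nat.lt_succ_iff.1 hi).eq_or_lt with rfl | hi
  · refine ⟨.W 1 le_rfl, i, ?_⟩
    convert hp.replace (.W 1 le_rfl) (by simp) (by simp) using 1
    ext ⟨x, y⟩
    rw [mem_stepSet_low (by omega), hS, Boundary.mem_join, Block.mem_intervals]
    simp only [Boundary.Mem, Block.Mem]
    grind
  · have h1 := hn i (p + 1) p p ((mem_stepSet_low (by omega)).2 (by simp))
      ((mem_stepSet_low (by omega)).2 (Or.inr (hS.2 (by simp)))) hi
    omega

theorem IsPrefix.step_W {k : ℕ} {hk : 1 ≤ k} (hp : IsPrefix S X p β (.W k hk))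
    (h : Chain (.W k hk) p S) (ht : IsTop S l m)
    (hn : NoNest (stepSet S l m i)) : ∃ B' p', Chain B' p' (stepSet S l m i) := by
  have hl : l = p + k := h.eq_end ht
  subst hl
  have hS := @hp.mem
  simp only [Block.Mem] at hS
  have hX := hp.le
  have hmem : (p + k - 1, p + k) ∈ S := hS.2 (.of_true (by omega) (by omega))
  have hm1 : m ≤ p + k - 1 := ht.2.2 _ hmem
  rcases lt_or_ge (p + k) i with hi | hi
  · exact h.step_high ht (by omega) hi
  rcases eq_or_ne i m with rfl | him
  · exact ⟨_, _, by rwa [stepSet_self ht]⟩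
  rcases hi.eq_or_lt with rfl | hi
  · refine ⟨.W (k + 1) (by omega), p, ?_⟩
    convert hp.replace (.W (k + 1) (by omega)) (by simp [Block.IsT, Block.IsW])
      (by simp [Block.IsW]) using 1
    refine hp.stepSet_eq ht (by omega) (by omega) (by omega) ?_ ?_ ?_ ?_ ?_ ?_
    all_goals
      simp only [Block.Mem]
      intros
      first | omega | exact iff_of_eq (congrArg _ (propext (by omega)))
  -- An added interval starting below p + k - 2 would contain [p + k - 2, p + k - 1]. For k = 1 that
  -- interval belongs to the preceding block, or, at a strong boundary, [p, p] takes its role.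
  have hlow : (i + 2 < p + k → ¬ i ≤ m) := by
    intro h1 h2
    have := hn i (p + k) (p + k - 2) (p + k - 1) ((mem_stepSet_low h2).2 (by simp))
    rcases eq_or_lt_of_le hk with rfl | hk2
    · cases β with
      | strong =>
        have := hn i (p + 1) p p ((mem_stepSet_low h2).2 (by simp))
          ((mem_stepSet_low h2).2 (Or.inr (hS.2 (by simp [Boundary.Mem])))) (by omega)
        omega
      | weak =>
        obtain ⟨h3, h4, -⟩ := hp.short (by simp)
        have := hn i (p + 1) (p - 1) p ((mem_stepSet_low h2).2 (by simp))
          ((mem_stepSet_low h2).2 (Or.inr (hS.2 (.of_true (.inl h4) (by omega))))) (by omega)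
        omega
      | weakOptional =>
        obtain ⟨h3, h4, -⟩ := hp.short (by simp)
        have := hn i (p + 1) (p - 1) p ((mem_stepSet_low h2).2 (by simp))
          ((mem_stepSet_low h2).2 (Or.inr (hS.2 (.of_true (.inl h4) (by omega))))) (by omega)
        omega
    · have := this ((mem_stepSet_low h2).2 (Or.inr (hS.2 (.of_true (by omega) (by omega)))))
        (by omega)
      omega
  rcases eq_or_lt_of_le hk with rfl | hk2
  · cases β with
    | strong =>
      have hm : m = p := by
        have := hS.1 ht.2.1
        have := hX m (p + 1)
        simp only [Boundary.Mem] at *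
        grind
      subst hm
      have h2 : i ≤ m := by omega
      have := hn i (m + 1) m m ((mem_stepSet_low h2).2 (by simp))
          ((mem_stepSet_low h2).2 (Or.inr (hS.2 (by simp [Boundary.Mem])))) (by omega)
      omega
    | weak =>
      have hm : m = p := by
        have := hS.1 ht.2.1
        have := hX m (p + 1)
        simp only [Boundary.Mem] at *
        grind
      subst hm
      have h2 : i ≤ m := by omega
      have h3 : i + 1 = m := by omega
      refine ⟨.W 1 hk, m, ?_⟩
      convert (hp.long (.inr ⟨rfl, trivial⟩)).2 using 1
      ext ⟨x, y⟩
      rw [mem_stepSet_low h2, Boundary.mem_join, Block.mem_intervals]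
      simp only [hS, Block.Mem]
      simp only [Boundary.Mem]
      grind
    | weakOptional =>
      obtain ⟨⟨a, ha, haX⟩, -⟩ := hp.long (.inl rfl)
      have hm : m = p - 1 := by
        have h1 := hS.1 ht.2.1
        have h2 := hX m (p + 1)
        have h3 := ht.2.2 (p - 1) (hS.2 (by simp [Boundary.Mem]))
        simp only [Boundary.Mem] at *
        grind
      subst hm
      obtain rfl : i = p := by omega
      have h2 := @mem_stepSet_mid _ _ _ _ ht (by omega : i - 1 < i) (by omega)
      -- The long interval [a, p] is stretched to [a, p + 1] while the optional interval is
      -- truncated to [p - 1, p]: a nesting.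
      have := hn a (i + 1) (i - 1) i (h2.2 (Or.inr (Or.inr (Or.inr (Or.inl ⟨by omega, by omega,
        by omega, hS.2 (.of_true (.inl haX) (by omega))⟩)))))
        (h2.2 (Or.inr (Or.inr (Or.inl ⟨by omega, rfl, hS.2 (by simp [Boundary.Mem])⟩))))
        (by omega)
      omega
  · have hm : m = p + k - 1 := by
      have := hS.1 ht.2.1
      have := hX m (p + k)
      cases β <;> simp only [Boundary.Mem] at * <;> grind
    subst hm
    have h2 : i ≤ p + k - 1 := by omega
    have h3 : i + 2 = p + k := by omega
    rcases eq_or_lt_of_le (Nat.succ_le_of_lt hk2) with hk3 | hk3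
    · obtain rfl : k = 2 := hk3.symm
      obtain rfl : i = p := by omega
      refine ⟨.C2, i, ?_⟩
      convert hp.replace .C2 (by simp [Block.IsT, Block.IsW]) (by simp [Block.IsC2]) using 1
      ext ⟨x, y⟩
      rw [mem_stepSet_low h2, Boundary.mem_join, Block.mem_intervals]
      simp only [hS, Block.Mem]
      cases β <;> simp only [Boundary.Mem] <;> grind
    · obtain ⟨j, rfl⟩ : ∃ j, k = j + 2 := ⟨k - 2, by omega⟩
      obtain rfl : i = p + j := by omega
      refine ⟨.C2, p + j, ?_⟩
      have hj : 1 ≤ j := by omega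
      convert (hp.replace (.W j hj) (by simp [Block.IsT, Block.IsW])
        (by simp [Block.IsW])).snoc (B := .C2) .weak
          (by simp [Boundary.Permitted, Block.IsT, Block.IsW]) using 1
      · rfl
      ext ⟨x, y⟩
      simp only [mem_stepSet_low h2, Boundary.mem_join, Block.mem_intervals]
      simp only [hS, Block.Mem, Block.size]
      -- Adding [p + j, p + j + 2] to `W (j + 2)` gives `W j` and `C2` joined weakly at p + j. The
      -- rest checks that this boundary does not interfere with `β` at p.
      have h4 : ((x = p + j ∧ y = p + (j + 2)) ∨ (x = p ∧ y = p) ∨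
          (x = p + (j + 2) ∧ y = p + (j + 2)) ∨ (p ≤ x ∧ x < p + (j + 2) ∧ y = x + 1)) ↔
          (((x = p ∧ y = p) ∨ (x = p + j ∧ y = p + j) ∨ (p ≤ x ∧ x < p + j ∧ y = x + 1)) ∨
            ((x = p + j ∧ p + j ≤ y ∧ y ≤ p + j + 2) ∨
              (y = p + j + 2 ∧ p + j < x ∧ x ≤ p + j + 2))) ∧ ¬ (x = p + j ∧ y = p + j) := by
        clear * - hj
        constructor
        · rintro (h | h | h | h) <;> omega
        · rintro ⟨(h | h | h) | h | h, h'⟩ <;> omega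
      have h5 : x = p + j ∧ y = p + (j + 2) → ¬ (x = p ∧ y = p) := by omega
      have h6 : ((x = p + j ∧ p + j ≤ y ∧ y ≤ p + j + 2) ∨
        (y = p + j + 2 ∧ p + j < x ∧ x ≤ p + j + 2)) → ¬ (x = p ∧ y = p) := by omega
      have h7 : (x, y) ∈ X → ¬ (x = p + j ∧ y = p + j) := fun h => by
        have := hX x y h
        omega
      have h8 : x = p - 1 ∧ y = p + 1 → ¬ (x = p + j ∧ y = p + j) := by omega
      clear * - h4 h5 h6 h7 h8
      rw [show ∀ P, Boundary.Mem (p + j) x y .weak P ↔ P ∧ ¬ (x = p + j ∧ y = p + j) from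
        fun _ => Iff.rfl]
      revert h4 h5 h6 h7 h8
      generalize ((x = p + j ∧ p + j ≤ y ∧ y ≤ p + j + 2) ∨
        (y = p + j + 2 ∧ p + j < x ∧ x ≤ p + j + 2)) = C
      generalize ((x = p ∧ y = p) ∨ (x = p + j ∧ y = p + j) ∨
        (p ≤ x ∧ x < p + j ∧ y = x + 1)) = D
      generalize ((x = p ∧ y = p) ∨
          (x = p + (j + 2) ∧ y = p + (j + 2)) ∨ (p ≤ x ∧ x < p + (j + 2) ∧ y = x + 1)) = E
      generalize (x = p + j ∧ y = p + (j + 2)) = F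
      generalize (x = p + j ∧ y = p + j) = G
      generalize ((x, y) ∈ X) = P
      cases β <;> simp only [Boundary.Mem]
      all_goals
        generalize (x = p ∧ y = p) = H
        try generalize (x = p - 1 ∧ y = p + 1) = K
        grind

theorem IsPrefix.step_C2 (hp : IsPrefix S X p β .C2) (h : Chain .C2 p S) (ht : IsTop S l m)
    (hn : NoNest (stepSet S l m i)) : ∃ B' p', Chain B' p' (stepSet S l m i) := by
  have hl : l = p + 2 := h.eq_end ht
  subst hl
  have hS := @hp.mem
  simp only [Block.Mem] at hS
  have hX := hp.le
  have hm : m = p := by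
    have h1 := hS.1 ht.2.1
    have h2 := hX m (p + 2)
    have h3 := ht.2.2 p (hS.2 (.of_true (by omega) (by omega)))
    cases β <;> simp only [Boundary.Mem] at * <;> grind
  subst hm
  rcases lt_or_ge (m + 2) i with hi | hi
  · exact h.step_high ht (by omega) hi
  rcases eq_or_ne i m with rfl | him
  · exact ⟨_, _, by rwa [stepSet_self ht]⟩
  rcases hi.eq_or_lt with rfl | hi
  · exact h.step_top trivial ht (by omega)
  rcases lt_or_ge i m with h2 | h2
  · have := hn i (m + 2) m (m + 1) ((mem_stepSet_low h2.le).2 (by simp))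
      ((mem_stepSet_low h2.le).2 (Or.inr (hS.2 (.of_true (by omega) (by omega))))) h2
    omega
  obtain rfl : i = m + 1 := by omega
  have hmid := @mem_stepSet_mid _ _ _ _ ht (by omega : m < m + 1) (by omega)
  -- With the optional interval, the move would produce [p - 1, p + 2] around [p, p + 1].
  by_cases ho : β = .weakOptional
  · subst ho
    have h4 := (hp.short (by simp)).1
    have := hn (m - 1) (m + 2) m (m + 1) (hmid.2 (Or.inr (Or.inr (Or.inr (Or.inl ⟨by omega,
      by omega, by omega, hS.2 (by simp [Boundary.Mem])⟩)))))
      (hmid.2 (Or.inr (Or.inr (Or.inl ⟨by omega, rfl, hS.2 (by simp [Boundary.Mem])⟩))))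
      (by omega)
    omega
  · refine ⟨.U 3 le_rfl, m, ?_⟩
    convert hp.replace (.U 3 le_rfl) (by simp [Block.IsT, Block.IsW]) (by simp [ho]) using 1
    refine hp.stepSet_eq ht (by omega) (by omega) (by omega) ?_ ?_ ?_ ?_ ?_ ?_
    all_goals
      simp only [Block.Mem]
      intros
      first | omega | (cases β <;> simp only [Boundary.Mem] <;> grind)

theorem IsPrefix.step_U {k : ℕ} {hk : 3 ≤ k} (hp : IsPrefix S X p β (.U k hk))
    (h : Chain (.U k hk) p S) (ht : IsTop S l m)
    (hn : NoNest (stepSet S l m i)) : ∃ B' p', Chain B' p' (stepSet S l m i) := by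
  have hl : l = p + k := h.eq_end ht
  subst hl
  have ho : β ≠ .weakOptional := by
    rintro rfl
    simpa [Block.IsW, Block.IsC2] using hp.optional rfl
  have hS := @hp.mem
  simp only [Block.Mem] at hS
  have hX := hp.le
  have hm : m = p + 1 := by
    have h1 := hS.1 ht.2.1
    have h2 := hX m (p + k)
    have h3 := ht.2.2 (p + 1) (hS.2 (.of_true (by omega) (by omega)))
    cases β <;> simp only [Boundary.Mem] at * <;> grind
  subst hm
  rcases lt_or_ge (p + k) i with hi | hi
  · exact h.step_high ht (by omega) hi
  rcases eq_or_ne i (p + 1) with rfl | him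
  · exact ⟨_, _, by rwa [stepSet_self ht]⟩
  rcases hi.eq_or_lt with rfl | hi
  · exact h.step_top trivial ht (by omega)
  rcases lt_trichotomy i p with h2 | rfl | h2
  · have := hn i (p + k) p (p + 1) ((mem_stepSet_low (by omega)).2 (by simp))
      ((mem_stepSet_low (by omega)).2 (Or.inr (hS.2 (.of_true (by omega) (by omega))))) h2
    omega
  · refine ⟨.C k hk, i, ?_⟩
    convert hp.replace (.C k hk) (by simp [Block.IsT, Block.IsW]) (by simp [ho]) using 1
    ext ⟨x, y⟩
    rw [mem_stepSet_low (by omega), Boundary.mem_join, Block.mem_intervals]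
    simp only [hS, Block.Mem]
    cases β <;> simp only [Boundary.Mem] <;> grind
  · have hmid := @mem_stepSet_mid _ _ _ _ ht (by omega : p + 1 < i) (by omega)
    -- The move stretches [p, p + k - 1] to [p, p + k] and truncates [p + 1, p + k] to [p + 1, i],
    -- which lies inside it.
    have := hn p (p + k) (p + 1) i
      (hmid.2 (Or.inr (Or.inr (Or.inr (Or.inl ⟨by omega, by omega, by omega,
        hS.2 (.of_true (by omega) (by omega))⟩)))))
      (hmid.2 (Or.inr (Or.inr (Or.inl ⟨by omega, rfl, ht.2.1⟩))))
      (by omega)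
    omega

theorem IsPrefix.step_C {k : ℕ} {hk : 3 ≤ k} (hp : IsPrefix S X p β (.C k hk))
    (h : Chain (.C k hk) p S) (ht : IsTop S l m)
    (hn : NoNest (stepSet S l m i)) : ∃ B' p', Chain B' p' (stepSet S l m i) := by
  have hl : l = p + k := h.eq_end ht
  subst hl
  have ho : β ≠ .weakOptional := by
    rintro rfl
    simpa [Block.IsW, Block.IsC2] using hp.optional rfl
  have hS := @hp.mem
  simp only [Block.Mem] at hS
  have hX := hp.le
  have hm : m = p := by
    have h1 := hS.1 ht.2.1
    have h2 := hX m (p + k)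
    have h3 := ht.2.2 p (hS.2 (.of_true (by omega) (by omega)))
    cases β <;> simp only [Boundary.Mem] at * <;> grind
  subst hm
  rcases lt_or_ge (m + k) i with hi | hi
  · exact h.step_high ht (by omega) hi
  rcases eq_or_ne i m with rfl | him
  · exact ⟨_, _, by rwa [stepSet_self ht]⟩
  rcases hi.eq_or_lt with rfl | hi
  · exact h.step_top trivial ht (by omega)
  rcases lt_or_ge i m with h2 | h2
  · have := hn i (m + k) m (m + 1) ((mem_stepSet_low (by omega)).2 (by simp))
      ((mem_stepSet_low (by omega)).2 (Or.inr (hS.2 (.of_true (by omega) (by omega))))) h2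
    omega
  have hmid := @mem_stepSet_mid _ _ _ _ ht (by omega : m < i) (by omega)
  rcases eq_or_ne i (m + 1) with rfl | h3
  · refine ⟨.U (k + 1) (by omega), m, ?_⟩
    convert hp.replace (.U (k + 1) (by omega)) (by simp [Block.IsT, Block.IsW])
      (by simp [ho]) using 1
    refine hp.stepSet_eq ht (by omega) (by omega) (by omega) ?_ ?_ ?_ ?_ ?_ ?_
    all_goals
      simp only [Block.Mem]
      intros
      first | omega | (cases β <;> simp only [Boundary.Mem] <;> grind)
  · have := hn m (m + k) (m + 1) i
      (hmid.2 (Or.inr (Or.inr (Or.inr (Or.inl ⟨by omega, by omega, by omega,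
        hS.2 (.of_true (by omega) (by omega))⟩)))))
      (hmid.2 (Or.inr (Or.inr (Or.inl ⟨by omega, rfl,
        hS.2 (.of_true (by omega) (by omega))⟩))))
      (by omega)
    omega

theorem Chain.step (h : Chain B p S) (ht : IsTop S l m) (hn : NoNest (stepSet S l m i)) :
    ∃ B' p', Chain B' p' (stepSet S l m i) := by
  obtain ⟨X, β, hp⟩ := h.exists_prefix
  cases B with
  | T1 => exact hp.step_T1 h ht hn
  | W k hk => exact hp.step_W h ht hn
  | C2 => exact hp.step_C2 h ht hn
  | U k hk => exact hp.step_U h ht hn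
  | C k hk => exact hp.step_C h ht hn

end

/-! ### Uniqueness of the block description -/

theorem chainIntervals_bounds {b : ℕ} {A : Block} {rest : List (Boundary × Block)} {x y : ℕ}
    (h : (x, y) ∈ chainIntervals b A rest) : b ≤ x ∧ x ≤ y := by
  induction rest generalizing b A with
  | nil =>
    have := (Block.mem_intervals.1 h).bounds
    exact ⟨this.1, this.2.1⟩
  | cons c rest ih =>
    obtain ⟨β, B⟩ := c
    have := A.one_le_size
    rcases (Boundary.mem_join.1 h).elim with (h | h) | h
    · have := (Block.mem_intervals.1 h).bounds
      omega
    · have := ih h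
      omega
    · omega

/-- Left of the end of the first block, the intervals are those of that block, except perhaps
for one optional interval. -/
theorem exists_mem_chainIntervals_iff {b : ℕ} {A : Block} {rest : List (Boundary × Block)}
    (hA : ChainPermitted A rest) : ∃ o : Prop, (o → A.IsCOrU) ∧ ∀ x y, x < b + A.size →
      ((x, y) ∈ chainIntervals b A rest ↔
        A.Mem b x y ∨ (o ∧ x = b + A.size - 1 ∧ y = b + A.size + 1)) := by
  cases rest with
  | nil => exact ⟨False, False.elim, fun x y _ => by simp [chainIntervals, Block.mem_intervals]⟩
  | cons c rest =>
    obtain ⟨β, B⟩ := c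
    refine ⟨β = .weakOptional, ?_, fun x y hx => ?_⟩
    · rintro rfl
      exact hA.1.1
    · have : (x, y) ∉ chainIntervals (b + A.size) B rest := fun h => by
        have := chainIntervals_bounds h
        omega
      simp only [chainIntervals, Boundary.mem_join, this, or_false, Block.mem_intervals]
      cases β <;> simp [Boundary.Mem, hx.ne]

theorem first_mem_chainIntervals {b : ℕ} {A : Block} {rest : List (Boundary × Block)}
    (hA : ChainPermitted A rest) : (b, b) ∈ chainIntervals b A rest := by
  obtain ⟨o, -, h⟩ := exists_mem_chainIntervals_iff (b := b) hA
  exact (h b b (by have := A.one_le_size; omega)).2 (Or.inl (A.mem_first b))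

theorem exists_lt_mem_chainIntervals {b : ℕ} {A : Block} {rest : List (Boundary × Block)}
    (hA : ChainPermitted A rest) : ∃ I ∈ chainIntervals b A rest, b < I.2 := by
  by_cases hT : A.IsT
  · refine ⟨(b + 1, b + 1), ?_, Nat.lt_succ_self b⟩
    cases A <;> simp only [Block.IsT] at hT
    cases rest with
    | nil => simp [chainIntervals, Block.intervals]
    | cons c rest =>
      obtain ⟨β, B⟩ := c
      have hβ : β = .strong := by
        have := hA.1
        cases β <;> simp_all [Boundary.Permitted, Block.IsT, Block.IsCOrU]
      subst hβ
      exact Or.inl (by simp [Block.intervals])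
  · obtain ⟨o, -, h⟩ := exists_mem_chainIntervals_iff (b := b) hA
    have := A.one_le_size
    refine ⟨(b, b + 1), (h b (b + 1) (by omega)).2 (Or.inl ?_), Nat.lt_succ_self b⟩
    cases A <;> simp only [Block.IsT, not_true] at hT <;>
      simp only [Block.Mem, true_and, and_true] <;> omega

/-- Detects where a `W` ends: [p, p] is missing there only at a weak boundary, and then the next
block is a 𝒞 or 𝒰, which contains [p, p + 2]. Inner points of a `W` have neither interval. -/
theorem mem_chainIntervals_W_end {b k : ℕ} {hk : 1 ≤ k} {rest : List (Boundary × Block)}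
    (hA : ChainPermitted (.W k hk) rest) :
    (b + k, b + k) ∈ chainIntervals b (.W k hk) rest ∨
      (b + k, b + k + 2) ∈ chainIntervals b (.W k hk) rest := by
  cases rest with
  | nil => simp [chainIntervals, Block.intervals]
  | cons c rest =>
    obtain ⟨β, B⟩ := c
    cases β with
    | strong => exact Or.inl (Or.inl (by simp [Block.intervals]))
    | weak =>
      right
      obtain ⟨o, -, h⟩ := exists_mem_chainIntervals_iff (b := b + k) hA.2
      have h1 := hA.1
      refine Boundary.mem_join.2 (.of_true (Or.inr ((h _ _ ?_).2 (Or.inl ?_))) (Or.inr ?_))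
      · have := B.one_le_size
        omega
      · cases B <;> simp_all [Boundary.Permitted, Block.IsT, Block.IsW, Block.Mem] <;> omega
      · simp only [Block.size]
        omega
    | weakOptional => exact absurd hA.1.1 (by simp [Block.IsCOrU])

theorem not_mem_chainIntervals_W {b k : ℕ} {hk : 1 ≤ k} {rest : List (Boundary × Block)}
    (hA : ChainPermitted (.W k hk) rest) {j : ℕ} (hj : 1 ≤ j) (hjk : j < k) :
    (b + j, b + j) ∉ chainIntervals b (.W k hk) rest ∧
      (b + j, b + j + 2) ∉ chainIntervals b (.W k hk) rest := by
  obtain ⟨o, ho, h⟩ := exists_mem_chainIntervals_iff (b := b) hA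
  have ho' : ¬ o := fun h => by simpa [Block.IsCOrU] using ho h
  simp only [Block.size, ho', false_and, or_false, Block.Mem] at h
  rw [h _ _ (by omega), h _ _ (by omega)]
  omega

/-- The intervals starting at b separate all cases except the length of a `W`, found from its end,
and `C2` against `U 3` or `C k` against `U (k + 1)`. In these, [b + 1, b + k] (k = 2 for `C2`)
belongs only to the 𝒞. -/
theorem first_block_eq {b : ℕ} {A A' : Block} {rest rest' : List (Boundary × Block)}
    (hA : ChainPermitted A rest) (hA' : ChainPermitted A' rest')
    (he : chainIntervals b A rest = chainIntervals b A' rest') : A = A' := by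
  obtain ⟨o, ho, h⟩ := exists_mem_chainIntervals_iff (b := b) hA
  obtain ⟨o', ho', h'⟩ := exists_mem_chainIntervals_iff (b := b) hA'
  have hs := A.one_le_size
  have hs' := A'.one_le_size
  have key : ∀ x y, x < b + A.size → x < b + A'.size →
      ((A.Mem b x y ∨ (o ∧ x = b + A.size - 1 ∧ y = b + A.size + 1)) ↔
        (A'.Mem b x y ∨ (o' ∧ x = b + A'.size - 1 ∧ y = b + A'.size + 1))) := by
    intro x y h1 h2
    rw [← h x y h1, ← h' x y h2, he]
  have key0 : ∀ j, A.Mem b b (b + j) ↔ A'.Mem b b (b + j) := by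
    intro j
    have h1 : ¬ (o ∧ b = b + A.size - 1 ∧ b + j = b + A.size + 1) := by
      rintro ⟨h1, h2, -⟩
      have := (ho h1).two_le_size
      omega
    have h2 : ¬ (o' ∧ b = b + A'.size - 1 ∧ b + j = b + A'.size + 1) := by
      rintro ⟨h1, h2, -⟩
      have := (ho' h1).two_le_size
      omega
    simpa only [h1, h2, or_false] using key b (b + j) (by omega) (by omega)
  have k1 := key0 1
  have k2 := key0 2
  have k3 := key0 A.size
  have k4 := key0 A'.size
  have k5 := key0 (A.size - 1)
  have k6 := key0 (A'.size - 1)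
  -- Right endpoints are bounded by both sizes to exclude optional intervals: [b + 1, b + 3] is in
  -- `U 3` and may also be optional after `C2`.
  have k7 : 2 ≤ A.size → 2 ≤ A'.size → ∀ j, j ≤ A.size → j ≤ A'.size →
      (A.Mem b (b + 1) (b + j) ↔ A'.Mem b (b + 1) (b + j)) := by
    intro h1 h2 j hj hj'
    have h3 : b + j ≠ b + A.size + 1 := by omega
    have h4 : b + j ≠ b + A'.size + 1 := by omega
    simpa only [h3, h4, and_false, or_false] using key (b + 1) (b + j) (by omega) (by omega)
  have k8 := fun h1 h2 => k7 h1 h2 A.size le_rfl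
  have k9 := fun h1 h2 h3 => k7 h1 h2 A'.size h3 le_rfl
  clear k7 key key0 h h' ho ho'
  cases A <;> cases A' <;>
    simp only [Block.Mem, Block.size, reduceCtorEq, Block.W.injEq, Block.U.injEq,
      Block.C.injEq] at *
  case W.W k hk j hj =>
    by_contra hne
    rcases lt_or_gt_of_ne hne with hl | hl
    · have h1 := mem_chainIntervals_W_end (b := b) hA
      have h2 := not_mem_chainIntervals_W (b := b) hA' hk hl
      rw [he] at h1
      exact h1.elim h2.1 h2.2
    · have h1 := mem_chainIntervals_W_end (b := b) hA'
      have h2 := not_mem_chainIntervals_W (b := b) hA hj hl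
      rw [← he] at h1
      exact h1.elim h2.1 h2.2
  all_goals
    clear he hA hA'
    grind

theorem chainIntervals_singleton_ne {b : ℕ} {A B : Block} {β : Boundary}
    {rest : List (Boundary × Block)} (hB : ChainPermitted B rest) :
    chainIntervals b A [] ≠ chainIntervals b A ((β, B) :: rest) := by
  intro h
  obtain ⟨⟨x, y⟩, hI, h2⟩ := exists_lt_mem_chainIntervals (b := b + A.size) hB
  have h3 : (x, y) ∈ chainIntervals b A [] := by
    rw [h]
    exact Boundary.mem_join.2 (.of_true (Or.inr hI) (Or.inr h2.ne'))
  have := (Block.mem_intervals.1 h3).bounds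
  simp only at h2
  omega

theorem mem_tail_chainIntervals_iff {b : ℕ} {A B : Block} {β : Boundary}
    {rest : List (Boundary × Block)} (hB : ChainPermitted B rest) (x y : ℕ) :
    (x, y) ∈ chainIntervals (b + A.size) B rest ↔
      (b + A.size ≤ x ∧ (x, y) ∈ chainIntervals b A ((β, B) :: rest)) ∨
        (x = b + A.size ∧ y = b + A.size) := by
  have hA := A.one_le_size
  simp only [chainIntervals, Boundary.mem_join, Block.mem_intervals]
  constructor
  · intro h
    by_cases h1 : x = b + A.size ∧ y = b + A.size
    · exact Or.inr h1
    · exact Or.inl ⟨(chainIntervals_bounds h).1, .of_true (Or.inr h) (by omega)⟩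
  · rintro (⟨h, h1⟩ | ⟨rfl, rfl⟩)
    · rcases h1.elim with (h1 | h1) | h1
      · have := h1.bounds
        obtain ⟨rfl, rfl⟩ : x = b + A.size ∧ y = b + A.size := by omega
        exact first_mem_chainIntervals hB
      · exact h1
      · omega
    · exact first_mem_chainIntervals hB

theorem boundary_eq_strong_iff {b : ℕ} {A B : Block} {β : Boundary}
    {rest : List (Boundary × Block)} : β = .strong ↔
      (b + A.size, b + A.size) ∈ chainIntervals b A ((β, B) :: rest) := by
  simp only [chainIntervals, Boundary.mem_join, Block.mem_intervals]
  cases β <;> simp [Boundary.Mem, A.mem_last b]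

theorem boundary_eq_weakOptional_iff {b : ℕ} {A B : Block} {β : Boundary}
    {rest : List (Boundary × Block)} : β = .weakOptional ↔
      (b + A.size - 1, b + A.size + 1) ∈ chainIntervals b A ((β, B) :: rest) := by
  have hA := A.one_le_size
  have h1 : ¬ A.Mem b (b + A.size - 1) (b + A.size + 1) := fun h => by
    have := h.bounds
    omega
  have h2 : (b + A.size - 1, b + A.size + 1) ∉ chainIntervals (b + A.size) B rest := fun h => by
    have := chainIntervals_bounds h
    omega
  simp only [chainIntervals, Boundary.mem_join, Block.mem_intervals, h1, h2, or_self]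
  cases β <;> simp [Boundary.Mem]

theorem chainIntervals_injective {b : ℕ} {A A' : Block} {rest rest' : List (Boundary × Block)}
    (hA : ChainPermitted A rest) (hA' : ChainPermitted A' rest')
    (he : chainIntervals b A rest = chainIntervals b A' rest') : A = A' ∧ rest = rest' := by
  induction rest generalizing b A A' rest' with
  | nil =>
    obtain rfl := first_block_eq hA hA' he
    cases rest' with
    | nil => exact ⟨rfl, rfl⟩
    | cons c rest' => exact absurd he (chainIntervals_singleton_ne hA'.2)
  | cons c rest ih =>
    obtain rfl := first_block_eq hA hA' he
    cases rest' with
    | nil => exact absurd he.symm (chainIntervals_singleton_ne hA.2)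
    | cons c' rest' =>
      obtain ⟨β, B⟩ := c
      obtain ⟨β', B'⟩ := c'
      have hβ : β = β' := by
        have h1 : β = .strong ↔ β' = .strong := by
          rw [boundary_eq_strong_iff, he, ← boundary_eq_strong_iff]
        have h2 : β = .weakOptional ↔ β' = .weakOptional := by
          rw [boundary_eq_weakOptional_iff, he, ← boundary_eq_weakOptional_iff]
        cases β <;> cases β' <;> simp_all
      have hY : chainIntervals (b + A.size) B rest = chainIntervals (b + A.size) B' rest' := by
        ext ⟨x, y⟩
        rw [mem_tail_chainIntervals_iff (β := β) hA.2, he, ← mem_tail_chainIntervals_iff hA'.2]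
      obtain ⟨rfl, rfl⟩ := ih hA.2 hA'.2 hY
      subst hβ
      exact ⟨rfl, rfl⟩

theorem BlockStructure.intervals_injective {s t : BlockStructure} (hs : s.Permitted)
    (ht : t.Permitted) (h : s.intervals = t.intervals) : s = t := by
  have hT : ∀ {A rest}, ChainPermitted A rest → chainIntervals 0 A rest ≠ {(0, 0)} := by
    intro A rest hA he
    obtain ⟨I, hI, h0⟩ := exists_lt_mem_chainIntervals (b := 0) hA
    rw [he] at hI
    obtain rfl := Set.mem_singleton_iff.1 hI
    exact absurd h0 (lt_irrefl _)
  cases s with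
  | T0 =>
    cases t with
    | T0 => rfl
    | chain A rest => exact absurd h.symm (hT ht)
  | chain A rest =>
    cases t with
    | T0 => exact absurd h (hT hs)
    | chain A' rest' =>
      obtain ⟨rfl, rfl⟩ := chainIntervals_injective hs ht h
      rfl

/-! ### Existence of a block description -/

theorem exists_chain_of_noNest (x : List ℕ)
    (hx : ∀ n ≤ x.length, NoNest {I | I ∈ (x.take n).foldl step [(0, 0)]}) :
    {I | I ∈ x.foldl step [(0, 0)]} = {(0, 0)} ∨
      ∃ B p, Chain B p {I | I ∈ x.foldl step [(0, 0)]} := by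
  induction x using List.reverseRecOn with
  | nil => exact Or.inl (by simp)
  | append_singleton x i ih =>
    have hlast := hx (x ++ [i]).length le_rfl
    rw [List.take_length] at hlast
    have ih' := ih fun n hn => by
      have := hx n (by rw [List.length_append]; omega)
      rwa [List.take_append_of_le_length hn] at this
    rw [List.foldl_append, List.foldl_cons, List.foldl_nil, setOf_mem_step] at hlast ⊢
    have ht := isTop_list (isFull_singleton.foldl_step x).1
    rcases ih' with h0 | ⟨B, p, h⟩
    · rw [h0] at ht ⊢
      obtain ⟨hl, hm⟩ := ht.unique (l' := 0) (m' := 0) ⟨by simp, by simp, by simp⟩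
      rw [hl, hm]
      rcases Nat.eq_zero_or_pos i with rfl | hi
      · exact Or.inl (by simp [stepSet])
      · refine Or.inr ⟨.T1, 0, ?_⟩
        convert Chain.single .T1 using 1
        ext I
        simp [stepSet, hi.ne', Block.intervals, or_comm]
    · exact Or.inr (h.step ht hlast)

theorem exists_blockStructure_of_noNest (x : List ℕ)
    (hx : ∀ n ≤ x.length, NoNest {I | I ∈ (x.take n).foldl step [(0, 0)]}) :
    ∃ s : BlockStructure, s.Permitted ∧ s.intervals = {I | I ∈ x.foldl step [(0, 0)]} := by
  rcases exists_chain_of_noNest x hx with h | ⟨B, p, h⟩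
  · exact ⟨.T0, trivial, h.symm⟩
  · obtain ⟨A, rest, h1, -, -, h2⟩ := h.exists_blockStructure
    exact ⟨.chain A rest, h1, h2⟩

end HereditarySemiorder

open HereditarySemiorder in
theorem theorem2p4 {α : Type*} [Finite α] [PartialOrder α]
    (hα : HereditarySemiorder.IsHereditarySemiorder α) :
    ∃! s : HereditarySemiorder.BlockStructure,
      s.Permitted ∧ s.intervals = HereditarySemiorder.minEndpointIntervals α := by
  obtain ⟨-, x, ⟨⟨h0, -⟩, ⟨e⟩⟩, hs⟩ := hα
  cases x with
  | nil => simp at h0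
  | cons a x =>
    have hfull := isFull_intervalsOfSeq (List.cons_ne_nil a x)
    rw [hfull.minEndpointIntervals_eq e]
    obtain ⟨s, hp, hi⟩ := exists_blockStructure_of_noNest x fun n hn =>
      (isFull_singleton.foldl_step _).noNest
        (hs (n + 1) (Nat.le_add_left _ _) (Nat.succ_le_succ hn))
    exact ⟨s, ⟨hp, hi⟩, fun t ht =>
      BlockStructure.intervals_injective ht.1 hp (ht.2.trans hi.symm)⟩
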